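/- Let $G=(V,E)$ be a finite connected simple graph with $n=|V|\ge 2$ vertices, let $d_i$ be the degree of the vertex $i$, and put $$I(x)=\sum_{\{i,j\}\in E}|x_i-x_j|,\qquad X=\Big\{x\in\mathbb R^V:\ \sum_{i\in V}d_i|x_i|=1\Big\}.$$ For a closed set $A=-A\subset\mathbb R^V\setminus\{0\}$ let $\gamma(A)$ be its Krasnoselskii genus, i.e. the least $d\ge 0$ such that there is an odd continuous map from $A$ to the unit sphere of $\mathbb R^d$ (so $\gamma(\emptyset)=0$), and $\gamma(A)=\infty$ if there is none. For $1\le k\le n$ define $$c_k=\inf\Big\{\max_{x\in A}I(x):\ A\subset X\text{ closed},\ A=-A,\ \gamma(A)\ge k\Big\},\qquad h_k=\min_{(S_1,\dots,S_k)}\ \max_{1\le i\le k}\frac{|\partial S_i|}{\mathrm{vol}(S_i)},$$ where $(S_1,\dots,S_k)$ ranges over the $k$-tuples of pairwise disjoint nonempty subsets of $V$, $\partial S$ is the set of edges with exactly one end point in $S$, and $\mathrm{vol}(S)=\sum_{i\in S}d_i$. Let $\mathrm{Sgn}(t)=\{1\}$ for $t>0$, $\{-1\}$ for $t<0$, and $\mathrm{Sgn}(0)=[-1,1]$.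 A pair $(\mu,\phi)\in\mathbb R\times(\mathbb R^V\setminus\{0\})$ is an eigenpair of the graph $1$-Laplacian $\Delta_1$ if there are numbers $z_{ij}\in\mathrm{Sgn}(\phi_i-\phi_j)$ with $z_{ji}=-z_{ij}$, for adjacent $i,j$, such that $\sum_{j\sim i}z_{ij}\in\mu\, d_i\,\mathrm{Sgn}(\phi_i)$ for every $i\in V$. The strong nodal domains of $\phi$ are the connected components of the subgraphs of $G$ induced on $\{i:\phi_i>0\}$ and on $\{i:\phi_i<0\}$; let $S(\phi)$ be their total number. Then for every $k\in\{1,\dots,n\}$: 1. $c_k\le h_k$; 2. if $\phi$ is an eigenvector of $\Delta_1$ with eigenvalue $c_k$ and $S(\phi)\ge m$ for an integer $m\ge 1$, then $h_m\le c_k$. -/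

import Mathlib

namespace OneLaplacian

/-- The Krasnoselskii genus of a (closed, symmetric, zero-free) set `A`: the least `d` for which
there is an odd continuous map from `A` to the unit sphere of `ℝ^d`, and `⊤` if there is none.
The unit sphere of `ℝ^0` is empty, so the genus is `0` exactly when `A` is empty. -/
noncomputable def genus {E : Type*} [TopologicalSpace E] [Neg E] (A : Set E) : ℕ∞ :=
  ⨅ (d : ℕ) (_ : ∃ f : E → EuclideanSpace ℝ (Fin d),
    ContinuousOn f A ∧ (∀ x ∈ A, ‖f x‖ = 1) ∧ ∀ x ∈ A, f (-x) = -f x), (d : ℕ∞)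

/-- The set-valued sign: `{1}` on positive reals, `{-1}` on negative reals, `[-1, 1]` at zero. -/
def Sgn (t : ℝ) : Set ℝ :=
  {s | (0 < t → s = 1) ∧ (t < 0 → s = -1) ∧ (t = 0 → s ∈ Set.Icc (-1 : ℝ) 1)}

section Graph

variable {V : Type*} [Fintype V] [DecidableEq V] (G : SimpleGraph V) [DecidableRel G.Adj]

/-- The total variation `I(x) = ∑_{i ∼ j} |x_i - x_j|`, every edge being counted once. -/
noncomputable def totalVariation (x : V → ℝ) : ℝ :=
  ∑ e ∈ G.edgeFinset,
    Sym2.lift ⟨fun i j => |x i - x j|, fun i j => abs_sub_comm (x i) (x j)⟩ e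

/-- The piecewise linear manifold `X = {x : ∑ i, d_i |x_i| = 1}`. -/
def manifoldX : Set (V → ℝ) :=
  {x | ∑ i, (G.degree i : ℝ) * |x i| = 1}

/-- The minimax value `c_k = inf_{γ(A) ≥ k} max_{x ∈ A} I(x)`, where `A` ranges over the closed
symmetric subsets of `X`. It is taken in `EReal`, so that the infimum and the supremum have
no default values. -/
noncomputable def minimaxValue (k : ℕ) : EReal :=
  ⨅ (A : Set (V → ℝ)) (_ : A ⊆ manifoldX G ∧ IsClosed A ∧ (∀ x ∈ A, -x ∈ A) ∧
    (k : ℕ∞) ≤ genus A), ⨆ x ∈ A, (totalVariation G x : EReal)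

/-- `(μ, x)` is an eigenpair of the graph 1-Laplacian: `x ≠ 0` and `0 ∈ Δ₁ x - μ D Sgn(x)`. -/
def IsEigenpair (μ : ℝ) (x : V → ℝ) : Prop :=
  x ≠ 0 ∧ ∃ z : V → V → ℝ,
    (∀ i j, G.Adj i j → z i j ∈ Sgn (x i - x j) ∧ z j i = -z i j) ∧
    ∀ i, ∃ s ∈ Sgn (x i), ∑ j ∈ G.neighborFinset i, z i j = μ * (G.degree i : ℝ) * s

/-- The volume of a set of vertices: the sum of the degrees. -/
def vol (S : Finset V) : ℕ := ∑ i ∈ S, G.degree i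

/-- `|∂S| / vol(S)`. A boundary edge is recorded by its ordered pair of end points, the one
in `S` first, so every boundary edge is counted once. -/
noncomputable def expansion (S : Finset V) : ℝ :=
  ((G.interedges S Sᶜ).card : ℝ) / (vol G S : ℝ)

/-- The `k`-way Cheeger constant: the minimum of `max_i |∂S_i| / vol(S_i)` over all families of
`k` pairwise disjoint nonempty sets of vertices (in `EReal`, hence `⊤` if there is no
such family). -/
noncomputable def cheegerConst (k : ℕ) : EReal :=
  ⨅ (S : Fin k → Finset V) (_ : (∀ i, (S i).Nonempty) ∧ ∀ i j, i ≠ j → Disjoint (S i) (S j)),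
    ⨆ i, (expansion G (S i) : EReal)

end Graph

/-- The number of strong nodal domains of `x`: the connected components of the subgraphs induced
on `{x > 0}` and on `{x < 0}`. -/
noncomputable def strongNodalCount {V : Type*} (G : SimpleGraph V) (x : V → ℝ) : ℕ :=
  Nat.card (G.induce {i | 0 < x i}).ConnectedComponent +
    Nat.card (G.induce {i | x i < 0}).ConnectedComponent

end OneLaplacian

/-!
The upper bound on the minimax value is a statement about the genus. Disjoint sets `S i` span a
cross-polytope of step functions inside the manifold `X`, on which the total variation is at most
the largest expansion of the `S i` (`totalVariation_stepFunction_le`). This cross-polytope is an odd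
continuous image of the `ℓ¹` sphere of `ℝᵏ`, so its genus is at least `k` by the Borsuk–Ulam
theorem (`le_of_odd_map_crossSphere`, `le_genus_image`).

The Borsuk–Ulam theorem is proved with mod 2 chains of ordered simplices. The `ℓ¹` sphere carries
hemispheres `C k` with `∂ C (k + 1) = C k + (-C k)`, and barycentric subdivision makes their
simplices as small as desired while keeping these relations (`exists_fine_hemispheres`). For an odd
map `f` to the unit sphere of `ℝᵈ`, let `pᵢ` be the sign of the coordinate `fᵢ`. The antipode changes
each `pᵢ` by `1`, so the coboundary of `p_k ∪ δp_(k-1) ∪ ⋯ ∪ δp_0` compares the values of consecutive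
cocycles on consecutive hemispheres, and all these values are `1` (`signCocycle_hemisphere`). A
simplex of `C d` on which the cocycle `δp_(d-1) ∪ ⋯ ∪ δp_0` does not vanish sees both signs of every
coordinate (`signCocycle_eq_zero`); if it is small, every coordinate of `f` is small on it, which
contradicts `‖f‖ = 1`.

The bound for eigenvectors is elementary. Summing the eigenvalue equation over a strong nodal domain,
the contributions of the inner edges cancel and every boundary edge contributes `1` up to the sign
of the domain. Hence the expansion of every strong nodal domain equals the eigenvalue
(`expansion_nodalDomain`), and the strong nodal domains are disjoint and nonempty.
-/

namespace OneLaplacian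

/-! ### Mod 2 chains of finite lists -/

/-- Mod 2 chains whose simplices are lists of points. The list of length `n + 1` is an ordered
`n`-simplex, degenerate ones are allowed, and the empty list is the generator of the augmented
degree `-1`. -/
abbrev Chain (E : Type*) : Type _ := List E →₀ ZMod 2

namespace Chain

variable {E F : Type*}

/-- The cone over a chain, with the apex as new first vertex. -/
noncomputable def cone (a : E) : Chain E →ₗ[ZMod 2] Chain E :=
  Finsupp.lmapDomain (ZMod 2) (ZMod 2) (List.cons a)

/-- The boundary of a single simplex, the sum of all lists with one entry removed. -/
noncomputable def simplexBoundary : List E → Chain E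
  | [] => 0
  | a :: l => Finsupp.single l 1 + cone a (simplexBoundary l)

/-- The boundary operator of the augmented complex. -/
noncomputable def boundary : Chain E →ₗ[ZMod 2] Chain E :=
  Finsupp.linearCombination (ZMod 2) simplexBoundary

/-- The chain map induced by a map of the vertices. -/
noncomputable def push (g : E → F) : Chain E →ₗ[ZMod 2] Chain F :=
  Finsupp.lmapDomain (ZMod 2) (ZMod 2) (List.map g)

@[simp] lemma cone_single (a : E) (l : List E) :
    cone a (Finsupp.single l 1) = Finsupp.single (a :: l) 1 := by
  simp [cone]

@[simp] lemma boundary_single (l : List E) :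
    boundary (Finsupp.single l 1) = simplexBoundary l := by
  simp [boundary]

@[simp] lemma push_single (g : E → F) (l : List E) :
    push g (Finsupp.single l 1) = Finsupp.single (l.map g) 1 := by
  simp [push]

/-- Two linear maps agree as soon as they agree on simplices. -/
lemma hom_ext {M : Type*} [AddCommGroup M] [Module (ZMod 2) M] {S T : Chain E →ₗ[ZMod 2] M}
    (h : ∀ l, S (Finsupp.single l 1) = T (Finsupp.single l 1)) (c : Chain E) : S c = T c := by
  have : S = T := Finsupp.lhom_ext' fun l => LinearMap.ext_ring (h l)
  rw [this]

lemma add_self (c : Chain E) : c + c = 0 := by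
  ext l
  exact CharTwo.add_self_eq_zero _

lemma boundary_cone (a : E) (c : Chain E) :
    boundary (cone a c) = c + cone a (boundary c) := by
  refine hom_ext (S := boundary ∘ₗ cone a) (T := LinearMap.id + cone a ∘ₗ boundary) ?_ c
  intro l
  simp [simplexBoundary]

lemma boundary_boundary (c : Chain E) : boundary (boundary c) = 0 := by
  refine hom_ext (S := boundary ∘ₗ boundary) (T := 0) ?_ c
  intro l
  induction l with
  | nil => simp [simplexBoundary]
  | cons a l ih =>
    simp only [LinearMap.comp_apply, boundary_single, LinearMap.zero_apply] at ih ⊢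
    simp only [simplexBoundary, map_add, boundary_single, boundary_cone, ih, map_zero, add_zero,
      add_self]

lemma push_cone (g : E → F) (a : E) (c : Chain E) :
    push g (cone a c) = cone (g a) (push g c) := by
  refine hom_ext (S := push g ∘ₗ cone a) (T := cone (g a) ∘ₗ push g) ?_ c
  intro l
  simp

lemma boundary_push (g : E → F) (c : Chain E) :
    boundary (push g c) = push g (boundary c) := by
  refine hom_ext (S := boundary ∘ₗ push g) (T := push g ∘ₗ boundary) ?_ c
  intro l
  induction l with
  | nil => simp [simplexBoundary]
  | cons a l ih =>
    simp only [LinearMap.comp_apply, boundary_single, push_single] at ih ⊢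
    simp [simplexBoundary, ih, push_cone]

/-- The chains all of whose simplices satisfy `P`. -/
noncomputable abbrev supp (P : List E → Prop) : Submodule (ZMod 2) (Chain E) :=
  Finsupp.supported (ZMod 2) (ZMod 2) {l | P l}

lemma single_mem_supp {P : List E → Prop} {l : List E} (h : P l) :
    (Finsupp.single l 1 : Chain E) ∈ supp P :=
  Finsupp.single_mem_supported _ _ h

lemma supp_mono {P Q : List E → Prop} (h : ∀ l, P l → Q l) {c : Chain E} (hc : c ∈ supp P) :
    c ∈ supp Q :=
  Finsupp.supported_mono (fun l hl => h l hl) hc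

/-- A linear map sends chains supported in `P` to `N` as soon as it does so on simplices. -/
lemma map_mem_of_mem_supp {M : Type*} [AddCommGroup M] [Module (ZMod 2) M]
    {P : List E → Prop} {N : Submodule (ZMod 2) M} (T : Chain E →ₗ[ZMod 2] M)
    (h : ∀ l, P l → T (Finsupp.single l 1) ∈ N) {c : Chain E} (hc : c ∈ supp P) : T c ∈ N := by
  have h1 : supp P ≤ N.comap T := by
    rw [supp, Finsupp.supported_eq_span_single, Submodule.span_le]
    rintro _ ⟨l, hl, rfl⟩
    exact h l hl
  exact h1 hc

/-- Linear maps that agree on the simplices satisfying `P` agree on the chains supported there. -/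
lemma eq_of_mem_supp {M : Type*} [AddCommGroup M] [Module (ZMod 2) M]
    {P : List E → Prop} (S T : Chain E →ₗ[ZMod 2] M)
    (h : ∀ l, P l → S (Finsupp.single l 1) = T (Finsupp.single l 1)) {c : Chain E}
    (hc : c ∈ supp P) : S c = T c := by
  have := map_mem_of_mem_supp (N := ⊥) (S - T) (fun l hl => by simp [h l hl]) hc
  simpa [sub_eq_zero] using this

lemma cone_mem_supp {P Q : List E → Prop} {a : E} (h : ∀ l, P l → Q (a :: l)) {c : Chain E}
    (hc : c ∈ supp P) : cone a c ∈ supp Q :=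
  map_mem_of_mem_supp _ (fun l hl => by simpa using single_mem_supp (h l hl)) hc

lemma simplexBoundary_mem_supp (l : List E) :
    simplexBoundary l ∈ supp fun m => m.Sublist l ∧ m.length + 1 = l.length := by
  induction l with
  | nil => exact zero_mem _
  | cons a l ih =>
    refine add_mem (single_mem_supp ⟨List.sublist_cons_self a l, rfl⟩) (cone_mem_supp ?_ ih)
    rintro m ⟨h1, h2⟩
    exact ⟨h1.cons_cons a, by simp [h2]⟩

end Chain

/-! ### Cochains detecting sign changes -/

open Chain

/-- Multiplication of a linear functional by a function of the first vertex; the value on the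
empty list is `0`. -/
noncomputable def headMul {E : Type*} (p : E → ZMod 2) (w : Chain E →ₗ[ZMod 2] ZMod 2) :
    Chain E →ₗ[ZMod 2] ZMod 2 :=
  Finsupp.linearCombination (ZMod 2) fun l =>
    (l.head?.elim 0 p) * w (Finsupp.single l 1)

/-- The cocycle `δp₍ₖ₋₁₎ ∪ ⋯ ∪ δp₀` on simplices whose vertices are sequences of signs, where `pᵢ`
is the `i`-th sign. It is built as a coboundary of `pₖ ∪ (δp₍ₖ₋₁₎ ∪ ⋯ ∪ δp₀)`, starting from the
coboundary of the augmentation. -/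
noncomputable def signCocycle : ℕ → Chain (ℕ → ZMod 2) →ₗ[ZMod 2] ZMod 2
  | 0 => Finsupp.lapply [] ∘ₗ boundary
  | k + 1 => headMul (fun t => t k) (signCocycle k) ∘ₗ boundary

lemma signCocycle_boundary (k : ℕ) (c : Chain (ℕ → ZMod 2)) : signCocycle k (boundary c) = 0 := by
  cases k <;> simp [signCocycle, boundary_boundary]

lemma signCocycle_nil (k : ℕ) : signCocycle k (Finsupp.single [] 1) = 0 := by
  cases k <;> simp [signCocycle, simplexBoundary]

lemma headMul_single {E : Type*} (p : E → ZMod 2) (w : Chain E →ₗ[ZMod 2] ZMod 2) (l : List E) :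
    headMul p w (Finsupp.single l 1) = (l.head?.elim 0 p) * w (Finsupp.single l 1) := by
  simp [headMul]

/-- If the cocycle `w` is invariant under the antipode, then so is `δ(p ∪ w)`, since the antipode
adds `w` to `p ∪ w`. -/
lemma headMul_push_add_one (k : ℕ)
    (h : ∀ c, signCocycle k (push (fun t => t + 1) c) = signCocycle k c)
    (c : Chain (ℕ → ZMod 2)) :
    headMul (fun t => t k) (signCocycle k) (push (fun t => t + 1) c) =
      headMul (fun t => t k) (signCocycle k) c + signCocycle k c := by
  refine hom_ext (S := headMul (fun t => t k) (signCocycle k) ∘ₗ push (fun t => t + 1))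
    (T := headMul (fun t => t k) (signCocycle k) + signCocycle k) ?_ c
  intro l
  have hl := h (Finsupp.single l 1)
  rw [push_single] at hl
  cases l with
  | nil => simp [headMul_single, signCocycle_nil]
  | cons a l =>
    simp only [LinearMap.comp_apply, LinearMap.add_apply, push_single, headMul_single, hl]
    simp [add_mul]

lemma signCocycle_push_add_one (k : ℕ) (c : Chain (ℕ → ZMod 2)) :
    signCocycle k (push (fun t => t + 1) c) = signCocycle k c := by
  induction k generalizing c with
  | zero =>
    simp only [signCocycle, LinearMap.comp_apply, boundary_push]
    refine hom_ext (S := Finsupp.lapply [] ∘ₗ push (fun t : ℕ → ZMod 2 => t + 1))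
      (T := Finsupp.lapply []) ?_ (boundary c)
    intro l
    cases l <;> simp
  | succ k ih =>
    simp only [signCocycle, LinearMap.comp_apply, boundary_push]
    rw [headMul_push_add_one k ih, signCocycle_boundary, add_zero]

/-- The value of the cocycles on a system of hemispheres does not depend on the dimension. -/
lemma signCocycle_hemisphere {C : ℕ → Chain (ℕ → ZMod 2)} {N : ℕ}
    (h0 : boundary (C 0) = Finsupp.single [] 1)
    (h : ∀ k < N, boundary (C (k + 1)) = C k + push (fun t => t + 1) (C k)) :
    ∀ k ≤ N, signCocycle k (C k) = 1 := by
  intro k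
  induction k with
  | zero =>
    intro _
    simp [signCocycle, h0]
  | succ k ih =>
    intro hk
    rw [signCocycle, LinearMap.comp_apply, h k (by omega), map_add,
      headMul_push_add_one k (signCocycle_push_add_one k), ← add_assoc,
      CharTwo.add_self_eq_zero, zero_add, ih (by omega)]

/-- The cocycle vanishes on a simplex along which one of the signs involved is constant. -/
lemma signCocycle_eq_zero {i : ℕ} {v : ZMod 2} {k : ℕ} (hik : i < k) {l : List (ℕ → ZMod 2)}
    (hl : ∀ t ∈ l, t i = v) : signCocycle k (Finsupp.single l 1) = 0 := by
  have key : ∀ k, ∀ l : List (ℕ → ZMod 2), (∀ t ∈ l, t i = v) →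
      signCocycle (i + 1 + k) (Finsupp.single l 1) = 0 := by
    intro k
    induction k with
    | zero =>
      intro l hl
      have hb : simplexBoundary l ∈ supp fun m => ∀ t ∈ m, t i = v :=
        supp_mono (fun m hm t ht => hl t (hm.1.subset ht)) (simplexBoundary_mem_supp l)
      have hc := eq_of_mem_supp (headMul (fun t => t i) (signCocycle i)) (v • signCocycle i)
        (fun m hm => by
          rw [headMul_single]
          cases m with
          | nil => simp [signCocycle_nil]
          | cons a m => simp [hm a (by simp)]) hb
      have h0 := signCocycle_boundary i (Finsupp.single l 1)
      rw [boundary_single] at h0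
      simp only [signCocycle, LinearMap.comp_apply, boundary_single]
      rw [hc, LinearMap.smul_apply, h0, smul_zero]
    | succ k ih =>
      intro l hl
      have hb : simplexBoundary l ∈ supp fun m => ∀ t ∈ m, t i = v :=
        supp_mono (fun m hm t ht => hl t (hm.1.subset ht)) (simplexBoundary_mem_supp l)
      rw [← add_assoc, signCocycle, LinearMap.comp_apply, boundary_single]
      exact eq_of_mem_supp _ 0 (fun m hm => by
        rw [headMul_single, ih m hm, mul_zero, LinearMap.zero_apply]) hb
  obtain ⟨j, rfl⟩ := Nat.exists_eq_add_of_lt hik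
  have := key j l hl
  rwa [show i + 1 + j = i + j + 1 by omega] at this

/-! ### Barycentric subdivision -/

section Subdivision

variable {E : Type*} [NormedAddCommGroup E] [NormedSpace ℝ E]

/-- The barycenter of the entries of a list (`0` for the empty list). -/
noncomputable def barycenter (l : List E) : E := (l.length : ℝ)⁻¹ • l.sum

/-- Barycentric subdivision of chains whose simplices have at most `n` vertices: a simplex is
replaced by the cone from its barycenter over its subdivided boundary. -/
noncomputable def subdivide : ℕ → Chain E →ₗ[ZMod 2] Chain E
  | 0 => LinearMap.id
  | n + 1 => Finsupp.linearCombination (ZMod 2) fun l =>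
      cone (barycenter l) (subdivide n (simplexBoundary l))

lemma subdivide_succ_single (n : ℕ) (l : List E) :
    subdivide (n + 1) (Finsupp.single l 1) =
      cone (barycenter l) (subdivide n (simplexBoundary l)) := by
  simp [subdivide]

lemma boundary_subdivide (n : ℕ) (c : Chain E) :
    boundary (subdivide (n + 1) c) = subdivide n (boundary c) := by
  have hbb : ∀ l : List E, boundary (simplexBoundary l) = 0 := fun l => by
    rw [← boundary_single, boundary_boundary]
  induction n generalizing c with
  | zero =>
    have h := hom_ext (S := boundary ∘ₗ subdivide 1) (T := subdivide 0 ∘ₗ boundary)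
      (fun l => by
        rw [LinearMap.comp_apply, subdivide_succ_single, boundary_cone, LinearMap.comp_apply,
          boundary_single, subdivide, LinearMap.id_apply, hbb, map_zero, add_zero]) c
    exact h
  | succ n ih =>
    have h := hom_ext (S := boundary ∘ₗ subdivide (n + 2)) (T := subdivide (n + 1) ∘ₗ boundary)
      (fun l => by
        rw [LinearMap.comp_apply, subdivide_succ_single, boundary_cone, ih, hbb,
          map_zero, map_zero, add_zero, LinearMap.comp_apply, boundary_single]) c
    exact h

lemma barycenter_map_neg (l : List E) : barycenter (l.map fun x => -x) = -barycenter l := by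
  have : (l.map fun x => -x).sum = -l.sum := by
    induction l with
    | nil => simp
    | cons a l ih => simp [ih, add_comm]
  simp [barycenter, this]

lemma subdivide_push_neg (n : ℕ) (c : Chain E) :
    subdivide n (push (fun x => -x) c) = push (fun x => -x) (subdivide n c) := by
  induction n generalizing c with
  | zero => rfl
  | succ n ih =>
    have h := hom_ext (S := subdivide (n + 1) ∘ₗ push fun x => -x)
      (T := (push fun x => -x) ∘ₗ subdivide (n + 1))
      (fun l => by
        rw [LinearMap.comp_apply, LinearMap.comp_apply, push_single, subdivide_succ_single,
          subdivide_succ_single, push_cone, barycenter_map_neg, ← ih, ← boundary_single l,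
          ← boundary_push, push_single, boundary_single]) c
    exact h

/-- A simplex with at most `n` vertices, all of them in `K` and at mutual distance at most `D`. -/
def IsSmall (K : Set E) (n : ℕ) (D : ℝ) (l : List E) : Prop :=
  l.length ≤ n ∧ (∀ x ∈ l, x ∈ K) ∧ ∀ x ∈ l, ∀ y ∈ l, dist x y ≤ D

lemma barycenter_eq_sum (l : List E) :
    barycenter l = ∑ i : Fin l.length, (l.length : ℝ)⁻¹ • l[i] := by
  rw [barycenter, ← Finset.smul_sum]
  congr 1
  simp

lemma barycenter_mem {K : Set E} (hK : Convex ℝ K) {l : List E} (hl : l ≠ [])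
    (h : ∀ x ∈ l, x ∈ K) : barycenter l ∈ K := by
  have hpos : (l.length : ℝ) ≠ 0 := by simpa using hl
  rw [barycenter_eq_sum]
  refine hK.sum_mem (fun _ _ => by positivity) ?_ fun i _ => h _ (List.getElem_mem _)
  simp [hpos]

/-- The distance from the barycenter to a vertex is smaller than the diameter by the factor
`(l.length - 1) / l.length`, because one of the summands vanishes. -/
lemma dist_barycenter_le {l : List E} {D : ℝ} {N : ℕ} (hD : 0 ≤ D) (hN : l.length ≤ N + 1)
    (h : ∀ x ∈ l, ∀ y ∈ l, dist x y ≤ D) {x : E} (hx : x ∈ l) :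
    dist x (barycenter l) ≤ N / (N + 1) * D := by
  obtain ⟨j, hj, rfl⟩ := List.getElem_of_mem hx
  have hpos : (0 : ℝ) < l.length := by exact_mod_cast (by omega : 0 < l.length)
  have h1 : barycenter l - l[j] =
      ∑ i ∈ Finset.univ.erase (⟨j, hj⟩ : Fin l.length), (l.length : ℝ)⁻¹ • (l[i] - l[j]) := by
    rw [Finset.sum_erase _ (by simp)]
    simp only [smul_sub, Finset.sum_sub_distrib, barycenter_eq_sum]
    congr 1
    rw [← Finset.smul_sum, Finset.sum_const, Finset.card_univ, Fintype.card_fin,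
      ← Nat.cast_smul_eq_nsmul ℝ, smul_smul, inv_mul_cancel₀ hpos.ne', one_smul]
  rw [dist_comm, dist_eq_norm, h1]
  refine (norm_sum_le _ _).trans ?_
  have h2 : ∀ i ∈ Finset.univ.erase (⟨j, hj⟩ : Fin l.length),
      ‖(l.length : ℝ)⁻¹ • (l[i] - l[j])‖ ≤ (l.length : ℝ)⁻¹ * D := by
    intro i _
    rw [norm_smul, Real.norm_of_nonneg (by positivity), ← dist_eq_norm]
    exact mul_le_mul_of_nonneg_left (h _ (List.getElem_mem _) _ (List.getElem_mem _))
      (by positivity)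
  refine (Finset.sum_le_card_nsmul _ _ _ h2).trans ?_
  rw [Finset.card_erase_of_mem (Finset.mem_univ _), Finset.card_univ, Fintype.card_fin,
    nsmul_eq_mul, Nat.cast_sub (by omega), ← mul_assoc]
  refine mul_le_mul_of_nonneg_right ?_ hD
  rw [← div_eq_mul_inv, div_le_div_iff₀ hpos (by positivity)]
  have : (l.length : ℝ) ≤ N + 1 := by exact_mod_cast hN
  push_cast
  nlinarith

/-- Barycentric subdivision keeps simplices inside a convex set and shrinks their diameter. -/
lemma subdivide_mem_supp {N n : ℕ} (hn : n ≤ N + 1) {K : Set E} (hK : Convex ℝ K) {D : ℝ}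
    (hD : 0 ≤ D) {c : Chain E} (hc : c ∈ supp (IsSmall K n D)) :
    subdivide n c ∈ supp (IsSmall K n (N / (N + 1) * D)) := by
  have hr : (0 : ℝ) ≤ N / (N + 1) * D := by positivity
  induction n generalizing K c with
  | zero =>
    refine supp_mono (fun l hl => ?_) hc
    have : l = [] := by simpa using hl.1
    subst this
    exact ⟨le_rfl, by simp, by simp⟩
  | succ n ih =>
    refine map_mem_of_mem_supp _ (fun l hl => ?_) hc
    rw [subdivide_succ_single]
    rcases eq_or_ne l [] with rfl | hne
    · simp [simplexBoundary]
    have hball : ∀ x ∈ l, x ∈ K ∩ Metric.closedBall (barycenter l) (N / (N + 1) * D) :=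
      fun x hx => ⟨hl.2.1 x hx, dist_barycenter_le hD (hl.1.trans hn) hl.2.2 hx⟩
    have hb : simplexBoundary l ∈
        supp (IsSmall (K ∩ Metric.closedBall (barycenter l) (N / (N + 1) * D)) n D) := by
      refine supp_mono (fun m hm => ⟨?_, ?_, ?_⟩) (simplexBoundary_mem_supp l)
      · have := hl.1
        omega
      · exact fun x hx => hball x (hm.1.subset hx)
      · exact fun x hx y hy => hl.2.2 x (hm.1.subset hx) y (hm.1.subset hy)
    refine cone_mem_supp (fun m hm => ?_)
      (ih (by omega) (hK.inter (convex_closedBall _ _)) hb)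
    have hm2 : ∀ x ∈ m, dist x (barycenter l) ≤ N / (N + 1) * D := fun x hx => (hm.2.1 x hx).2
    refine ⟨by simpa using hm.1, ?_, ?_⟩
    · intro x hx
      rcases List.mem_cons.1 hx with rfl | hx
      · exact barycenter_mem hK hne hl.2.1
      · exact (hm.2.1 x hx).1
    · intro x hx y hy
      rcases List.mem_cons.1 hx with rfl | hx <;> rcases List.mem_cons.1 hy with rfl | hy
      · simpa using hr
      · rw [dist_comm]
        exact hm2 y hy
      · exact hm2 x hx
      · exact hm.2.2 x hx y hy

end Subdivision

/-! ### Hemispheres of the cross-polytope -/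

/-- The unit sphere of the `ℓ¹` norm, the boundary of the cross-polytope. -/
def crossSphere (ι : Type*) [Fintype ι] : Set (ι → ℝ) := {x | ∑ i, |x i| = 1}

/-- The coordinate vector number `k` (zero if `n ≤ k`). -/
def coordVec (n k : ℕ) : Fin n → ℝ := fun i => if i.val = k then 1 else 0

/-- The triangulated `k`-dimensional hemispheres of the cross-polytope: each one is the cone,
with apex the next coordinate vector, over the sphere formed by the previous hemisphere and its
antipode. -/
noncomputable def hemisphere (n : ℕ) : ℕ → Chain (Fin n → ℝ)
  | 0 => Finsupp.single [coordVec n 0] 1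
  | k + 1 => cone (coordVec n (k + 1)) (hemisphere n k + push (fun x => -x) (hemisphere n k))

lemma push_neg_push_neg {E : Type*} [AddGroup E] (c : Chain E) :
    push (fun x => -x) (push (fun x => -x) c) = c := by
  refine hom_ext (S := push (fun x : E => -x) ∘ₗ push (fun x => -x)) (T := LinearMap.id) ?_ c
  intro l
  simp

lemma boundary_hemisphere_zero (n : ℕ) :
    boundary (hemisphere n 0) = Finsupp.single [] 1 := by
  simp [hemisphere, simplexBoundary]

lemma boundary_hemisphere_succ (n k : ℕ) :
    boundary (hemisphere n (k + 1)) = hemisphere n k + push (fun x => -x) (hemisphere n k) := by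
  have hcone : ∀ k, boundary (hemisphere n k) + push (fun x => -x) (boundary (hemisphere n k)) = 0 →
      boundary (hemisphere n (k + 1)) =
        hemisphere n k + push (fun x => -x) (hemisphere n k) := by
    intro k hk
    rw [hemisphere, boundary_cone, map_add boundary, boundary_push, hk, map_zero, add_zero]
  refine hcone k ?_
  induction k with
  | zero => simp [boundary_hemisphere_zero, add_self]
  | succ k ih =>
    rw [hcone k ih, map_add, push_neg_push_neg, add_comm (push _ _), add_self]

lemma dist_le_two_of_mem_crossSphere {ι : Type*} [Fintype ι] {x y : ι → ℝ}
    (hx : x ∈ crossSphere ι) (hy : y ∈ crossSphere ι) : dist x y ≤ 2 := by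
  have key : ∀ z ∈ crossSphere ι, dist z 0 ≤ 1 := by
    intro z hz
    refine (dist_pi_le_iff zero_le_one).2 fun i => ?_
    rw [Pi.zero_apply, Real.dist_eq, sub_zero, ← (show ∑ i, |z i| = 1 from hz)]
    exact Finset.single_le_sum (f := fun i => |z i|) (fun _ _ => abs_nonneg _) (Finset.mem_univ i)
  have := dist_triangle_right x y 0
  linarith [key x hx, key y hy]

/-- Every simplex of a hemisphere lies in a face of the cross-polytope. -/
lemma hemisphere_mem_supp {n k : ℕ} (hk : k < n) :
    hemisphere n k ∈ supp fun l => ∃ K, Convex ℝ K ∧ K ⊆ crossSphere (Fin n) ∧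
      IsSmall K (k + 1) 2 l := by
  have key : ∀ k < n, hemisphere n k ∈ supp fun l => l.length ≤ k + 1 ∧
      ∃ ε : Fin n → ℝ, (∀ i, |ε i| = 1) ∧ ∀ x ∈ l,
        (∀ i, 0 ≤ ε i * x i) ∧ ∑ i, ε i * x i = 1 ∧ ∀ i : Fin n, k < i.val → x i = 0 := by
    have hvec : ∀ k (hk : k < n) (ε : Fin n → ℝ), ε ⟨k, hk⟩ = 1 →
        (∀ i, 0 ≤ ε i * coordVec n k i) ∧ ∑ i, ε i * coordVec n k i = 1 ∧
          ∀ i : Fin n, k < i.val → coordVec n k i = 0 := by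
      intro k hk ε hε
      have hi : ∀ i : Fin n, ε i * coordVec n k i = if i = ⟨k, hk⟩ then 1 else 0 := by
        intro i
        by_cases h : i = ⟨k, hk⟩
        · subst h
          simp [coordVec, hε]
        · have : i.val ≠ k := fun h' => h (Fin.ext h')
          simp [coordVec, h, this]
      refine ⟨fun i => ?_, by simp [hi], fun i hi => by simp [coordVec, hi.ne']⟩
      rw [hi]
      split_ifs <;> simp
    intro k
    induction k with
    | zero =>
      intro h0
      refine single_mem_supp ⟨by simp, fun _ => 1, by simp, fun x hx => ?_⟩
      rw [List.mem_singleton] at hx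
      subst hx
      exact hvec 0 h0 _ rfl
    | succ k ih =>
      intro hk
      have ih := ih (by omega)
      refine cone_mem_supp ?_ (add_mem ih (map_mem_of_mem_supp _ (fun l hl => ?_) ih))
      · rintro l ⟨h1, ε, h2, h3⟩
        refine ⟨by simpa using h1, Function.update ε ⟨k + 1, hk⟩ 1, fun i => ?_, fun x hx => ?_⟩
        · by_cases h : i = ⟨k + 1, hk⟩
          · subst h
            simp
          · simp [h, h2]
        · rcases List.mem_cons.1 hx with rfl | hx
          · exact hvec _ hk _ (by simp)
          · obtain ⟨h4, h5, h6⟩ := h3 x hx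
            have hup : ∀ i, Function.update ε ⟨k + 1, hk⟩ 1 i * x i = ε i * x i := by
              intro i
              by_cases h : i = ⟨k + 1, hk⟩
              · subst h
                rw [h6 _ (by simp)]
                simp
              · simp [h]
            simp only [hup]
            exact ⟨h4, h5, fun i hi => h6 i (by omega)⟩
      · obtain ⟨h1, ε, h2, h3⟩ := hl
        rw [push_single]
        refine single_mem_supp ⟨by simpa using h1, -ε, by simpa using h2, fun x hx => ?_⟩
        obtain ⟨y, hy, rfl⟩ := List.mem_map.1 hx
        obtain ⟨h4, h5, h6⟩ := h3 y hy
        simp only [Pi.neg_apply, neg_mul_neg, neg_eq_zero]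
        exact ⟨h4, h5, h6⟩
  refine supp_mono ?_ (key k hk)
  rintro l ⟨h1, ε, h2, h3⟩
  have hsub : {x : Fin n → ℝ | (∀ i, 0 ≤ ε i * x i) ∧ ∑ i, ε i * x i = 1} ⊆
      crossSphere (Fin n) := by
    rintro x ⟨h4, h5⟩
    have : ∀ i, |x i| = ε i * x i := fun i => by
      rw [← abs_of_nonneg (h4 i), abs_mul, h2, one_mul]
    simp only [crossSphere, Set.mem_ofPred_eq, this, h5]
  have hmem : ∀ x ∈ l, x ∈ {x : Fin n → ℝ | (∀ i, 0 ≤ ε i * x i) ∧ ∑ i, ε i * x i = 1} :=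
    fun x hx => ⟨(h3 x hx).1, (h3 x hx).2.1⟩
  refine ⟨_, ?_, hsub, h1, hmem, fun x hx y hy =>
    dist_le_two_of_mem_crossSphere (hsub (hmem x hx)) (hsub (hmem y hy))⟩
  rintro x ⟨hx1, hx2⟩ y ⟨hy1, hy2⟩ a b ha hb hab
  have hi : ∀ i, ε i * (a • x + b • y) i = a * (ε i * x i) + b * (ε i * y i) := fun i => by
    simp only [Pi.add_apply, Pi.smul_apply, smul_eq_mul]
    ring
  refine ⟨fun i => ?_, ?_⟩
  · rw [hi]
    exact add_nonneg (mul_nonneg ha (hx1 i)) (mul_nonneg hb (hy1 i))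
  · simp only [hi, Finset.sum_add_distrib, ← Finset.mul_sum, hx2, hy2, mul_one, hab]

/-- Iterated subdivision produces hemispheres built from arbitrarily small simplices. -/
lemma exists_fine_hemispheres (n : ℕ) {δ : ℝ} (hδ : 0 < δ) :
    ∃ C : ℕ → Chain (Fin n → ℝ), boundary (C 0) = Finsupp.single [] 1 ∧
      (∀ k, boundary (C (k + 1)) = C k + push (fun x => -x) (C k)) ∧
      ∀ k < n, C k ∈ supp fun l => ∃ K, Convex ℝ K ∧ K ⊆ crossSphere (Fin n) ∧
        IsSmall K (k + 1) δ l := by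
  have key : ∀ j : ℕ, ∃ C : ℕ → Chain (Fin n → ℝ), boundary (C 0) = Finsupp.single [] 1 ∧
      (∀ k, boundary (C (k + 1)) = C k + push (fun x => -x) (C k)) ∧
      ∀ k < n, C k ∈ supp fun l => ∃ K, Convex ℝ K ∧ K ⊆ crossSphere (Fin n) ∧
        IsSmall K (k + 1) ((n / (n + 1) : ℝ) ^ j * 2) l := by
    intro j
    induction j with
    | zero =>
      refine ⟨hemisphere n, boundary_hemisphere_zero n, boundary_hemisphere_succ n, ?_⟩
      intro k hk
      simpa using hemisphere_mem_supp hk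
    | succ j ih =>
      obtain ⟨C, h0, h1, h2⟩ := ih
      refine ⟨fun k => subdivide (k + 1) (C k), ?_, fun k => ?_, fun k hk => ?_⟩
      · rw [boundary_subdivide, h0]
        rfl
      · rw [boundary_subdivide, h1, map_add, subdivide_push_neg]
      · refine map_mem_of_mem_supp _ (fun l hl => ?_) (h2 k hk)
        obtain ⟨K, hK, hKs, hl⟩ := hl
        refine supp_mono (fun m hm => ⟨K, hK, hKs, ?_⟩)
          (subdivide_mem_supp (N := n) (by omega) hK (by positivity) (single_mem_supp hl))
        rwa [pow_succ', mul_assoc]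
  have hr : (n / (n + 1) : ℝ) < 1 := by
    rw [div_lt_one (by positivity)]
    linarith
  obtain ⟨j, hj⟩ := exists_pow_lt_of_lt_one (half_pos hδ) hr
  obtain ⟨C, h0, h1, h2⟩ := key j
  refine ⟨C, h0, h1, fun k hk => supp_mono ?_ (h2 k hk)⟩
  rintro l ⟨K, hK, hKs, h3, h4, h5⟩
  exact ⟨K, hK, hKs, h3, h4, fun x hx y hy => (h5 x hx y hy).trans (by linarith)⟩

/-! ### The Borsuk–Ulam theorem -/

/-- The sign of a real number attached to the point `x`, as an element of `ZMod 2`. For the value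
zero it is decided by an arbitrary choice of one point out of every pair `{x, -x}`, so that the
sign of an odd function changes under the antipode even at its zeros. -/
noncomputable def oddSign {E : Type*} [Neg E] (x : E) (t : ℝ) : ZMod 2 :=
  open Classical in if 0 < t ∨ (t = 0 ∧ WellOrderingRel x (-x)) then 1 else 0

lemma oddSign_neg {E : Type*} [InvolutiveNeg E] {x : E} (hx : x ≠ -x) (t : ℝ) :
    oddSign (-x) (-t) = oddSign x t + 1 := by
  have h2 : (1 + 1 : ZMod 2) = 0 := CharTwo.add_self_eq_zero 1
  unfold oddSign
  rcases lt_trichotomy t 0 with ht | rfl | ht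
  · simp [ht, ht.not_gt, ht.ne]
  · rcases trichotomous_of WellOrderingRel x (-x) with h | h | h
    · simp [h, asymm h, h2]
    · exact absurd h hx
    · simp [h, asymm h]
  · simp [ht, ht.not_gt, ht.ne', h2]

lemma mul_nonpos_of_oddSign_ne {E : Type*} [Neg E] {x y : E} {s t : ℝ}
    (h : oddSign x s ≠ oddSign y t) : s * t ≤ 0 := by
  by_contra! hst
  apply h
  unfold oddSign
  rcases pos_and_pos_or_neg_and_neg_of_mul_pos hst with ⟨h1, h2⟩ | ⟨h1, h2⟩
  · simp [h1, h2]
  · simp [h1.not_gt, h2.not_gt, h1.ne, h2.ne]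

lemma isCompact_crossSphere (ι : Type*) [Fintype ι] : IsCompact (crossSphere ι) := by
  refine Metric.isCompact_of_isClosed_isBounded ?_ ?_
  · exact isClosed_eq (by fun_prop) continuous_const
  · rw [Metric.isBounded_iff]
    exact ⟨2, fun x hx y hy => dist_le_two_of_mem_crossSphere hx hy⟩

/-- The Borsuk–Ulam theorem for the boundary of the cross-polytope in `ℝⁿ`: it has no odd
continuous map to the unit sphere of a space of smaller dimension. -/
theorem le_of_odd_map_crossSphere {n d : ℕ}
    (f : (Fin n → ℝ) → EuclideanSpace ℝ (Fin d)) (hf : ContinuousOn f (crossSphere (Fin n)))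
    (hf1 : ∀ x ∈ crossSphere (Fin n), ‖f x‖ = 1)
    (hodd : ∀ x ∈ crossSphere (Fin n), f (-x) = -f x) : n ≤ d := by
  by_contra! hd
  -- The constant `η` is chosen such that a vector of `ℝᵈ` with entries at most `2 * η` has
  -- norm less than `1`.
  set η : ℝ := 1 / (2 * (d + 1)) with hη
  have hη0 : 0 < η := by positivity
  obtain ⟨δ, hδ, hfδ⟩ := Metric.uniformContinuousOn_iff_le.1
    ((isCompact_crossSphere (Fin n)).uniformContinuousOn_of_continuous hf) η hη0
  obtain ⟨C, hC0, hC1, hC2⟩ := exists_fine_hemispheres n hδ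
  let g : (Fin n → ℝ) → ℕ → ℝ := fun x i => if h : i < d then f x ⟨i, h⟩ else 0
  let lab : (Fin n → ℝ) → ℕ → ZMod 2 := fun x i => oddSign x (g x i)
  have hlab : ∀ x ∈ crossSphere (Fin n), lab (-x) = lab x + 1 := by
    intro x hx
    have hne : x ≠ -x := by
      intro h
      have hx0 : x = 0 := self_eq_neg.1 h
      subst hx0
      simp [crossSphere] at hx
    funext i
    have : g (-x) i = -g x i := by
      by_cases hi : i < d <;> simp [g, hi, hodd x hx]
    simp only [lab, this, oddSign_neg hne, Pi.add_apply, Pi.one_apply]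
  have hone := signCocycle_hemisphere (C := fun k => push lab (C k)) (N := d)
    (by simp [boundary_push, hC0])
    (fun k hk => by
      rw [boundary_push, hC1, map_add]
      congr 1
      refine eq_of_mem_supp (push lab ∘ₗ push fun x => -x)
        (push (fun t => t + 1) ∘ₗ push lab) ?_ (hC2 k (by omega))
      rintro l ⟨K, -, hKs, -, hK, -⟩
      simp only [LinearMap.comp_apply, push_single, List.map_map]
      congr 1
      exact List.map_congr_left fun x hx => hlab x (hKs (hK x hx))) d le_rfl
  have hzero : (signCocycle d ∘ₗ push lab) (C d) =
      (0 : Chain (Fin n → ℝ) →ₗ[ZMod 2] ZMod 2) (C d) :=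
    eq_of_mem_supp _ _ (fun l hl => by
      obtain ⟨K, -, hKs, -, hK, hdist⟩ := hl
      rw [LinearMap.comp_apply, push_single, LinearMap.zero_apply]
      by_contra hne
      obtain ⟨x, hx⟩ : ∃ x, x ∈ l := by
        refine List.exists_mem_of_ne_nil l fun h => hne ?_
        rw [h, List.map_nil, signCocycle_nil]
      have hclose : ∀ y ∈ l, ∀ z ∈ l, ∀ i, |f y i - f z i| ≤ η := fun y hy z hz i => by
        have h1 := hfδ y (hKs (hK y hy)) z (hKs (hK z hz)) (hdist y hy z hz)
        rw [dist_eq_norm] at h1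
        exact (PiLp.norm_apply_le (f y - f z) i).trans h1
      have hsmall : ∀ i, |f x i| ≤ 2 * η := by
        intro i
        obtain ⟨y, hy, z, hz, hyz⟩ : ∃ y ∈ l, ∃ z ∈ l, lab y i ≠ lab z i := by
          by_contra! hall
          refine hne (signCocycle_eq_zero (i := i) (v := lab x i) i.2 fun t ht => ?_)
          obtain ⟨y, hy, rfl⟩ := List.mem_map.1 ht
          exact hall y hy x hx
        have h1 := mul_nonpos_of_oddSign_ne hyz
        simp only [g, i.2, dif_pos] at h1
        -- The values of opposite signs are at most `η` apart, so both of them are small.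
        have h2 : |f y i| ≤ η := by
          have h3 := hclose y hy z hz i
          rw [abs_le] at h3 ⊢
          rcases mul_nonpos_iff.1 h1 with h | h <;> constructor <;> linarith [h.1, h.2, h3.1, h3.2]
        have h3 := hclose x hx y hy i
        have h4 := abs_sub_abs_le_abs_sub (f x i) (f y i)
        linarith
      have hnorm : ‖f x‖ ^ 2 = 1 := by rw [hf1 x (hKs (hK x hx)), one_pow]
      rw [EuclideanSpace.norm_sq_eq] at hnorm
      have hsum : ∑ i, ‖f x i‖ ^ 2 ≤ ∑ _i : Fin d, (2 * η) ^ 2 :=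
        Finset.sum_le_sum fun i _ => pow_le_pow_left₀ (norm_nonneg _) (hsmall i) 2
      have hval : 2 * η = 1 / (d + 1) := by
        rw [hη]
        field_simp
      rw [hnorm, Finset.sum_const, Finset.card_univ, Fintype.card_fin, nsmul_eq_mul, hval,
        div_pow, one_pow, mul_one_div, le_div_iff₀ (by positivity)] at hsum
      nlinarith [(Nat.cast_nonneg d : (0 : ℝ) ≤ d)]) (hC2 d hd)
  rw [LinearMap.comp_apply, hone] at hzero
  exact one_ne_zero hzero

/-! ### Comparison of the minimax values with the Cheeger constants -/

section Graph

variable {V : Type*} [Fintype V] (G : SimpleGraph V) [DecidableRel G.Adj]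

lemma totalVariation_sum_le {ι : Type*} [Fintype ι] (b : ι → ℝ) (u : ι → V → ℝ) :
    totalVariation G (fun v => ∑ a, b a * u a v) ≤ ∑ a, |b a| * totalVariation G (u a) := by
  simp only [totalVariation, Finset.mul_sum]
  rw [Finset.sum_comm]
  refine Finset.sum_le_sum fun e _ => ?_
  induction e with | _ i j
  simp only [Sym2.lift_mk, ← Finset.sum_sub_distrib, ← mul_sub, ← abs_mul]
  exact Finset.abs_sum_le_sum_abs _ _

lemma vol_pos {G : SimpleGraph V} [DecidableRel G.Adj] (hdeg : ∀ v, 0 < G.degree v)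
    {S : Finset V} (hS : S.Nonempty) : 0 < vol G S :=
  Finset.sum_pos (fun v _ => hdeg v) hS

variable [DecidableEq V]

/-- The total variation of an indicator function is the number of boundary edges. -/
lemma totalVariation_indicator (S : Finset V) :
    totalVariation G (fun v => if v ∈ S then 1 else 0) = (G.interedges S Sᶜ).card := by
  have h : ∀ e : Sym2 V, Sym2.lift ⟨fun i j : V => |(if i ∈ S then (1 : ℝ) else 0) -
      if j ∈ S then 1 else 0|, fun i j => abs_sub_comm _ _⟩ e =
      if (∃ i ∈ S, ∃ j ∉ S, e = s(i, j)) then 1 else 0 := by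
    intro e
    induction e with | _ i j
    by_cases hi : i ∈ S <;> by_cases hj : j ∈ S
    · rw [if_neg (by rintro ⟨a, ha, b, hb, h⟩; grind [Sym2.eq_iff])]
      simp [hi, hj]
    · rw [if_pos ⟨i, hi, j, hj, rfl⟩]
      simp [hi, hj]
    · rw [if_pos ⟨j, hj, i, hi, Sym2.eq_swap⟩]
      simp [hi, hj]
    · rw [if_neg (by rintro ⟨a, ha, b, hb, h⟩; grind [Sym2.eq_iff])]
      simp [hi, hj]
  rw [totalVariation, Finset.sum_congr rfl fun e _ => h e, Finset.sum_boole, Nat.cast_inj]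
  symm
  refine Finset.card_bij (fun p _ => s(p.1, p.2)) ?_ ?_ ?_
  · rintro ⟨i, j⟩ hp
    rw [SimpleGraph.mem_interedges_iff] at hp
    simp only [Finset.mem_filter, SimpleGraph.mem_edgeFinset, SimpleGraph.mem_edgeSet]
    exact ⟨hp.2.2, i, hp.1, j, by simpa using hp.2.1, rfl⟩
  · rintro ⟨i, j⟩ hp ⟨i', j'⟩ hp' h
    rw [SimpleGraph.mem_interedges_iff, Finset.mem_compl] at hp hp'
    rcases Sym2.eq_iff.1 h with ⟨h1, h2⟩ | ⟨h1, h2⟩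
    · exact Prod.ext h1 h2
    · exact absurd (h1 ▸ hp.1) hp'.2.1
  · intro e he
    rw [Finset.mem_filter, SimpleGraph.mem_edgeFinset] at he
    obtain ⟨he, i, hi, j, hj, rfl⟩ := he
    exact ⟨(i, j), (SimpleGraph.mem_interedges_iff G).2 ⟨hi, by simpa using hj, he⟩, rfl⟩

/-- The step function with the value `a i / vol (S i)` on `S i`, for disjoint sets `S i`. -/
noncomputable def stepFunction {k : ℕ} (S : Fin k → Finset V) (a : Fin k → ℝ) : V → ℝ :=
  fun v => ∑ i, a i / (vol G (S i) : ℝ) * if v ∈ S i then 1 else 0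

variable {G}

lemma stepFunction_mem_manifoldX {k : ℕ} {S : Fin k → Finset V}
    (hS : ∀ i j, i ≠ j → Disjoint (S i) (S j)) (hvol : ∀ i, 0 < vol G (S i))
    {a : Fin k → ℝ} (ha : a ∈ crossSphere (Fin k)) : stepFunction G S a ∈ manifoldX G := by
  have habs : ∀ v, |stepFunction G S a v| =
      ∑ i, |a i| / (vol G (S i) : ℝ) * if v ∈ S i then 1 else 0 := by
    intro v
    by_cases hv : ∃ i, v ∈ S i
    · obtain ⟨i, hi⟩ := hv
      have hne : ∀ j, j ≠ i → v ∉ S j := fun j hj h =>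
        Finset.disjoint_left.1 (hS j i hj) h hi
      rw [stepFunction, Finset.sum_eq_single i (fun j _ hj => by simp [hne j hj]) (by simp),
        Finset.sum_eq_single i (fun j _ hj => by simp [hne j hj]) (by simp)]
      simp [hi, abs_div]
    · have hv : ∀ i, v ∉ S i := fun i hi => hv ⟨i, hi⟩
      simp [stepFunction, hv]
  change ∑ v, (G.degree v : ℝ) * |stepFunction G S a v| = 1
  simp only [habs, Finset.mul_sum]
  rw [Finset.sum_comm]
  refine (Finset.sum_congr rfl fun i _ => ?_).trans (show ∑ i, |a i| = 1 from ha)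
  have h0 : (vol G (S i) : ℝ) ≠ 0 := by exact_mod_cast (hvol i).ne'
  have : ∀ v, (G.degree v : ℝ) * (|a i| / (vol G (S i) : ℝ) * if v ∈ S i then 1 else 0) =
      |a i| / (vol G (S i) : ℝ) * if v ∈ S i then (G.degree v : ℝ) else 0 := by
    intro v
    split_ifs <;> ring
  simp only [this, ← Finset.mul_sum]
  rw [Finset.sum_ite_mem, Finset.univ_inter,
    show ∑ v ∈ S i, (G.degree v : ℝ) = (vol G (S i) : ℝ) by simp [vol], div_mul_cancel₀ _ h0]

lemma totalVariation_stepFunction_le {k : ℕ} (S : Fin k → Finset V) {a : Fin k → ℝ} :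
    totalVariation G (stepFunction G S a) ≤ ∑ i, |a i| * expansion G (S i) := by
  refine (totalVariation_sum_le G _ _).trans (le_of_eq (Finset.sum_congr rfl fun i _ => ?_))
  rw [totalVariation_indicator, abs_div, expansion, Nat.abs_cast]
  ring

lemma continuous_stepFunction {k : ℕ} (S : Fin k → Finset V) : Continuous (stepFunction G S) := by
  unfold stepFunction
  fun_prop

lemma stepFunction_neg {k : ℕ} (S : Fin k → Finset V) (a : Fin k → ℝ) :
    stepFunction G S (-a) = -stepFunction G S a := by
  funext v
  simp only [stepFunction, Pi.neg_apply, neg_div, neg_mul, Finset.sum_neg_distrib]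

lemma neg_mem_crossSphere {ι : Type*} [Fintype ι] {a : ι → ℝ} (ha : a ∈ crossSphere ι) :
    -a ∈ crossSphere ι := by
  simpa [crossSphere] using ha

/-- The genus does not decrease under odd continuous maps; the cross-polytope in `ℝᵏ` has genus
at least `k`. -/
lemma le_genus_image {E : Type*} [TopologicalSpace E] [Neg E] {k : ℕ} {T : (Fin k → ℝ) → E}
    (hT : Continuous T) (hodd : ∀ a, T (-a) = -T a) :
    (k : ℕ∞) ≤ genus (T '' crossSphere (Fin k)) := by
  refine le_iInf fun d => le_iInf fun h => ?_
  obtain ⟨f, hf, hf1, hf2⟩ := h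
  rw [Nat.cast_le]
  refine le_of_odd_map_crossSphere (f ∘ T)
    (hf.comp hT.continuousOn (Set.mapsTo_image T _)) (fun a ha => hf1 _ ⟨a, ha, rfl⟩)
    (fun a ha => ?_)
  rw [Function.comp_apply, hodd, hf2 _ ⟨a, ha, rfl⟩, Function.comp_apply]

/-- The minimax value is at most the Cheeger constant: disjoint sets `S i` span a cross-polytope
of step functions, on which the total variation is a convex combination of the expansions. -/
lemma minimaxValue_le_cheegerConst (hdeg : ∀ v, 0 < G.degree v) {k : ℕ} (hk : 1 ≤ k) :
    minimaxValue G k ≤ cheegerConst G k := by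
  refine le_iInf fun S => le_iInf fun hS => ?_
  obtain ⟨hne, hdisj⟩ := hS
  have hvol : ∀ i, 0 < vol G (S i) := fun i => vol_pos hdeg (hne i)
  have hA : stepFunction G S '' crossSphere (Fin k) ⊆ manifoldX G := by
    rintro _ ⟨a, ha, rfl⟩
    exact stepFunction_mem_manifoldX hdisj hvol ha
  have hneg : ∀ x ∈ stepFunction G S '' crossSphere (Fin k),
      -x ∈ stepFunction G S '' crossSphere (Fin k) := by
    rintro _ ⟨a, ha, rfl⟩
    exact ⟨-a, neg_mem_crossSphere ha, stepFunction_neg S a⟩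
  refine (iInf₂_le (stepFunction G S '' crossSphere (Fin k)) ⟨hA,
    ((isCompact_crossSphere _).image (continuous_stepFunction S)).isClosed, hneg,
    le_genus_image (continuous_stepFunction S) (stepFunction_neg S)⟩).trans ?_
  refine iSup₂_le ?_
  rintro _ ⟨a, ha, rfl⟩
  have : Nonempty (Fin k) := ⟨⟨0, hk⟩⟩
  obtain ⟨i₀, hi₀⟩ := Finite.exists_max fun i => expansion G (S i)
  refine le_trans ?_ (le_iSup (fun i => (expansion G (S i) : EReal)) i₀)
  rw [EReal.coe_le_coe_iff]
  refine (totalVariation_stepFunction_le S).trans ?_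
  calc ∑ i, |a i| * expansion G (S i) ≤ ∑ i, |a i| * expansion G (S i₀) :=
        Finset.sum_le_sum fun i _ => mul_le_mul_of_nonneg_left (hi₀ i) (abs_nonneg _)
    _ = expansion G (S i₀) := by
        rw [← Finset.sum_mul, show ∑ i, |a i| = 1 from ha, one_mul]

end Graph

/-! ### Nodal domains -/

section Components

variable {V : Type*} [Fintype V] {G : SimpleGraph V}

/-- The vertices of a connected component of an induced subgraph. -/
noncomputable def componentVerts {W : Set V} (C : (G.induce W).ConnectedComponent) : Finset V :=
  open Classical in Finset.univ.filter fun v =>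
    ∃ h : v ∈ W, (G.induce W).connectedComponentMk ⟨v, h⟩ = C

lemma mem_componentVerts {W : Set V} {C : (G.induce W).ConnectedComponent} {v : V} :
    v ∈ componentVerts C ↔ ∃ h : v ∈ W, (G.induce W).connectedComponentMk ⟨v, h⟩ = C := by
  simp [componentVerts]

lemma componentVerts_nonempty {W : Set V} (C : (G.induce W).ConnectedComponent) :
    (componentVerts C).Nonempty := by
  induction C using SimpleGraph.ConnectedComponent.ind with
  | h v => exact ⟨v, mem_componentVerts.2 ⟨v.2, rfl⟩⟩

lemma notMem_of_adj_componentVerts {W : Set V} {C : (G.induce W).ConnectedComponent} {i j : V}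
    (hi : i ∈ componentVerts C) (hj : j ∉ componentVerts C) (h : G.Adj i j) : j ∉ W := by
  intro hjW
  obtain ⟨hiW, rfl⟩ := mem_componentVerts.1 hi
  refine hj (mem_componentVerts.2 ⟨hjW, ?_⟩)
  rw [SimpleGraph.ConnectedComponent.eq]
  exact SimpleGraph.Adj.reachable (G := G.induce W) (u := ⟨j, hjW⟩) (v := ⟨i, hiW⟩) h.symm

lemma disjoint_componentVerts {W : Set V} {C D : (G.induce W).ConnectedComponent} (h : C ≠ D) :
    Disjoint (componentVerts C) (componentVerts D) := by
  refine Finset.disjoint_left.2 fun v hC hD => h ?_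
  obtain ⟨_, rfl⟩ := mem_componentVerts.1 hC
  obtain ⟨_, rfl⟩ := mem_componentVerts.1 hD
  rfl

lemma disjoint_componentVerts_of_disjoint {W W' : Set V} (h : Disjoint W W')
    (C : (G.induce W).ConnectedComponent) (D : (G.induce W').ConnectedComponent) :
    Disjoint (componentVerts C) (componentVerts D) :=
  Finset.disjoint_left.2 fun _ hC hD =>
    Set.disjoint_left.1 h (mem_componentVerts.1 hC).1 (mem_componentVerts.1 hD).1

end Components

section Graph

variable {V : Type*} [Fintype V] [DecidableEq V] {G : SimpleGraph V} [DecidableRel G.Adj]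

/-- A flow whose net outflow is `c * degree` on `S` and which is saturated on the boundary of `S`
forces the expansion of `S` to be `c`: the flow inside `S` cancels. -/
lemma expansion_eq_of_flow {S : Finset V} (hvol : 0 < vol G S) {c : ℝ} {z : V → V → ℝ}
    (hz : ∀ i j, G.Adj i j → z j i = -z i j)
    (hout : ∀ i ∈ S, ∑ j ∈ G.neighborFinset i, z i j = c * G.degree i)
    (hbd : ∀ i ∈ S, ∀ j ∉ S, G.Adj i j → z i j = 1) : expansion G S = c := by
  let t : V → V → ℝ := fun i j => if G.Adj i j then z i j else 0
  have ht : ∀ i j, t j i = -t i j := by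
    intro i j
    by_cases h : G.Adj i j
    · simp [t, h, h.symm, hz i j h]
    · simp [t, h, G.adj_comm j i]
  have hin : ∑ i ∈ S, ∑ j ∈ S, t i j = 0 := by
    have h1 : ∑ i ∈ S, ∑ j ∈ S, t i j = -∑ i ∈ S, ∑ j ∈ S, t i j := by
      conv_lhs => rw [Finset.sum_comm]
      simp only [← Finset.sum_neg_distrib, ← ht]
    linarith
  have hbdry : ∑ i ∈ S, ∑ j ∈ Sᶜ, t i j = (G.interedges S Sᶜ).card := by
    rw [SimpleGraph.interedges_def, ← Finset.sum_boole, Finset.sum_product]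
    refine Finset.sum_congr rfl fun i hi => Finset.sum_congr rfl fun j hj => ?_
    by_cases h : G.Adj i j
    · simp [t, h, hbd i hi j (Finset.mem_compl.1 hj) h]
    · simp [t, h]
  have htot : ∑ i ∈ S, ∑ j, t i j = c * vol G S := by
    rw [vol, Nat.cast_sum, Finset.mul_sum]
    refine Finset.sum_congr rfl fun i hi => ?_
    rw [← hout i hi, ← Finset.sum_filter]
    congr 1
    ext j
    simp
  have h0 : (vol G S : ℝ) ≠ 0 := by exact_mod_cast hvol.ne'
  rw [expansion, div_eq_iff h0, ← htot, ← hbdry, ← zero_add (∑ i ∈ S, ∑ j ∈ Sᶜ, t i j), ← hin,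
    ← Finset.sum_add_distrib]
  exact Finset.sum_congr rfl fun i _ => Finset.sum_add_sum_compl S _

/-- The expansion of a strong nodal domain of an eigenvector is the eigenvalue. -/
lemma expansion_nodalDomain (hdeg : ∀ v, 0 < G.degree v) {c : ℝ} {φ : V → ℝ}
    (h : IsEigenpair G c φ) :
    (∀ C : (G.induce {i | 0 < φ i}).ConnectedComponent, expansion G (componentVerts C) = c) ∧
    ∀ C : (G.induce {i | φ i < 0}).ConnectedComponent, expansion G (componentVerts C) = c := by
  obtain ⟨-, z, hz, hs⟩ := h
  refine ⟨fun C => ?_, fun C => ?_⟩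
  · refine expansion_eq_of_flow (z := z) (vol_pos hdeg (componentVerts_nonempty C))
      (fun i j hij => (hz i j hij).2) (fun i hi => ?_) fun i hi j hj hij => ?_
    · obtain ⟨s, hs1, hs2⟩ := hs i
      rw [hs2, hs1.1 (mem_componentVerts.1 hi).1, mul_one]
    · have hjW := notMem_of_adj_componentVerts hi hj hij
      have hi0 : 0 < φ i := (mem_componentVerts.1 hi).1
      have hj0 : φ j ≤ 0 := not_lt.1 hjW
      exact (hz i j hij).1.1 (by linarith)
  · refine expansion_eq_of_flow (z := fun i j => -z i j)
      (vol_pos hdeg (componentVerts_nonempty C))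
      (fun i j hij => by rw [(hz i j hij).2]) (fun i hi => ?_) fun i hi j hj hij => ?_
    · obtain ⟨s, hs1, hs2⟩ := hs i
      rw [Finset.sum_neg_distrib, hs2, hs1.2.1 (mem_componentVerts.1 hi).1]
      ring
    · have hjW := notMem_of_adj_componentVerts hi hj hij
      have hi0 : φ i < 0 := (mem_componentVerts.1 hi).1
      have hj0 : 0 ≤ φ j := not_lt.1 hjW
      rw [(hz i j hij).1.2.1 (by linarith), neg_neg]

lemma cheegerConst_le_of_isEigenpair (hdeg : ∀ v, 0 < G.degree v) {c : ℝ} {φ : V → ℝ}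
    (h : IsEigenpair G c φ) {m : ℕ} (hm : m ≤ strongNodalCount G φ) :
    cheegerConst G m ≤ c := by
  have : Finite (G.induce {i | 0 < φ i}).ConnectedComponent := Quot.finite _
  have : Finite (G.induce {i | φ i < 0}).ConnectedComponent := Quot.finite _
  rw [strongNodalCount, ← Nat.card_sum] at hm
  let e := (Fin.castLEEmb hm).trans (Finite.equivFin _).symm.toEmbedding
  let D : (G.induce {i | 0 < φ i}).ConnectedComponent ⊕
      (G.induce {i | φ i < 0}).ConnectedComponent → Finset V :=
    Sum.elim componentVerts componentVerts
  have hsep : Disjoint {i | 0 < φ i} {i | φ i < 0} :=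
    Set.disjoint_left.2 fun i (h1 : 0 < φ i) (h2 : φ i < 0) => lt_asymm h1 h2
  have hD : (∀ i, (D (e i)).Nonempty) ∧ ∀ i j, i ≠ j → Disjoint (D (e i)) (D (e j)) := by
    refine ⟨fun i => ?_, fun i j hij => ?_⟩
    · rcases e i with C | C <;> exact componentVerts_nonempty C
    have hne := e.injective.ne hij
    generalize e i = C at hne
    generalize e j = C' at hne
    rcases C with C | C <;> rcases C' with C' | C'
    · exact disjoint_componentVerts fun h => hne (by rw [h])
    · exact disjoint_componentVerts_of_disjoint hsep _ _
    · exact disjoint_componentVerts_of_disjoint hsep.symm _ _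
    · exact disjoint_componentVerts fun h => hne (by rw [h])
  refine (iInf₂_le (fun i => D (e i)) hD).trans (iSup_le fun i => ?_)
  rw [EReal.coe_le_coe_iff]
  change expansion G (D (e i)) ≤ c
  rcases e i with C | C
  · exact ((expansion_nodalDomain hdeg h).1 C).le
  · exact ((expansion_nodalDomain hdeg h).2 C).le

end Graph

end OneLaplacian

theorem theorem5p2 {V : Type*} [Fintype V] [DecidableEq V] [Nontrivial V]
    (G : SimpleGraph V) [DecidableRel G.Adj] (hG : G.Connected)
    (k : ℕ) (hk1 : 1 ≤ k) (hkn : k ≤ Fintype.card V) :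
    OneLaplacian.minimaxValue G k ≤ OneLaplacian.cheegerConst G k ∧
    ∀ (c : ℝ) (φ : V → ℝ), (c : EReal) = OneLaplacian.minimaxValue G k →
      OneLaplacian.IsEigenpair G c φ →
      ∀ m : ℕ, 1 ≤ m → m ≤ OneLaplacian.strongNodalCount G φ →
        OneLaplacian.cheegerConst G m ≤ OneLaplacian.minimaxValue G k := by
  have hdeg : ∀ v, 0 < G.degree v := fun v => hG.preconnected.degree_pos_of_nontrivial v
  refine ⟨OneLaplacian.minimaxValue_le_cheegerConst hdeg hk1, fun c φ hc hφ m _ hm => ?_⟩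
  rw [← hc]
  exact OneLaplacian.cheegerConst_le_of_isEigenpair hdeg hφ hm
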